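/- For $0\le k<1$ let $K(k)=\int_0^{\pi/2}\frac{d\varphi}{\sqrt{1-k^2\sin^2\varphi}}$ and $E(k)=\int_0^{\pi/2}\sqrt{1-k^2\sin^2\varphi}\,d\varphi$ be Legendre's complete elliptic integrals of the first and second kind with modulus $k$. (1) For every $t>0$ the integral $$f(t)=\int_0^1\left(\frac1{k+t}+\frac1{1+tk}\right)K(k)\,dk$$ converges; the function $f$ is real analytic on $(0,\infty)$, and $$f(t)=\frac{\pi}{2}K\!\left(\sqrt{1-t^2}\right)\ \ (0<t\le1),\qquad f(t)=\frac{\pi}{2t}K\!\left(\sqrt{1-t^{-2}}\right)\ \ (t>1).$$ (2) Let $\Sigma=\mathbb C/2\pi i\mathbb Z$ be the cylinder with coordinate $z=x+iy$ and flat metric $dx^2+dy^2$. Consider the maps $W:\Sigma\to\mathbb{CP}^1$, $W(z)=\alpha\,\mathrm{sech}\,z$, $\alpha\in\mathbb C^\times$, forming the surface $\Xi_0$. Let $\gamma$ be the $L^2$ metric determined by the flat metric on $\Sigma$ and the round metric of the unit sphere on $\mathbb{CP}^1$, that is, $$\gamma|_W(X,Y)=\int_{\Sigma}\frac{4\,\mathrm{Re}(X\overline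 Y)}{(1+|W|^2)^2}\,dx\,dy .$$ In polar coordinates $\alpha=ae^{i\vartheta}$, $a>0$, the integrals defining $\gamma$ on tangent vectors of $\Xi_0$ converge, and $\gamma|_{\Xi_0}=I(a)\,(da^2+a^2d\vartheta^2)$ with $$I(a)=4\int_{-\pi}^{\pi}\int_{-\infty}^{\infty}\frac{|\mathrm{sech}\,z|^2}{(1+a^2|\mathrm{sech}\,z|^2)^2}\,dx\,dy .$$ For all $a>0$, $$I(a)=16f(a^2)+16a^2f'(a^2),$$ and $$I(a)=\frac{8\pi}{a^4-1}\left(E\!\left(\sqrt{1-a^4}\right)-K\!\left(\sqrt{1-a^4}\right)\right)\quad(0<a<1),$$ $$I(a)=\frac{8\pi}{a^4-1}\left(a^2E\!\left(\sqrt{1-a^{-4}}\right)-a^{-2}K\!\left(\sqrt{1-a^{-4}}\right)\right)\quad(a>1).$$ At $a=1$, $I$ is continuous and $I(1)=2\pi^2$, which is the common limit of both expressions. -/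

import Mathlib

open Set MeasureTheory Filter Topology

noncomputable section

namespace CylinderLump

/-- Legendre's complete elliptic integral of the first kind, as a function of the modulus `k`,
`K(k) = ∫₀^{π/2} dφ / √(1 - k² sin² φ)`. -/
def ellipticK (k : ℝ) : ℝ :=
  ∫ φ in (0 : ℝ)..(Real.pi / 2), 1 / Real.sqrt (1 - k ^ 2 * Real.sin φ ^ 2)

/-- Legendre's complete elliptic integral of the second kind, as a function of the modulus `k`,
`E(k) = ∫₀^{π/2} √(1 - k² sin² φ) dφ`. -/
def ellipticE (k : ℝ) : ℝ :=
  ∫ φ in (0 : ℝ)..(Real.pi / 2), Real.sqrt (1 - k ^ 2 * Real.sin φ ^ 2)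

/-- The integrand `(1/(k+t) + 1/(1+tk)) K(k)`. -/
def kernelIntegrand (t k : ℝ) : ℝ :=
  (1 / (k + t) + 1 / (1 + t * k)) * ellipticK k

/-- `f(t) = ∫₀¹ (1/(k+t) + 1/(1+tk)) K(k) dk`. -/
def kernelIntegral (t : ℝ) : ℝ :=
  ∫ k in (0 : ℝ)..1, kernelIntegrand t k

/-- The strip `-π < Im z ≤ π`, a fundamental domain for the cylinder `Σ = ℂ / 2πiℤ`. The flat
measure `dx dy` of the cylinder is Lebesgue measure on this strip. -/
def cylinderStrip : Set ℂ := {z : ℂ | z.im ∈ Ioc (-Real.pi) Real.pi}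

/-- Pointwise inner product of two tangent vectors `X`, `Y` at the map `W`, with respect to the
round metric `4 |dW|² / (1 + |W|²)²` of the unit two-sphere. Maps to `ℂP¹` are given in the
inhomogeneous coordinate; the poles of the maps considered are a null set. -/
def sphereInner (W X Y : ℂ → ℂ) (z : ℂ) : ℝ :=
  4 * (X z * (starRingEnd ℂ) (Y z)).re / (1 + ‖W z‖ ^ 2) ^ 2

/-- The `L²` metric `γ|_W(X, Y)` on maps from the cylinder to the unit two-sphere. -/
def l2Metric (W X Y : ℂ → ℂ) : ℝ :=
  ∫ z in cylinderStrip, sphereInner W X Y z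

/-- The two-lump `z ↦ α sech z`. -/
def sechLump (α z : ℂ) : ℂ := α * (Complex.cosh z)⁻¹

/-- The parametrisation of `Ξ₀ = {α sech z : α ∈ ℂˣ}` by polar coordinates
`α = a e^{iϑ}`, with `q = (a, ϑ)`. -/
def polarLump (q : ℝ × ℝ) (z : ℂ) : ℂ :=
  sechLump (q.1 * Complex.exp (q.2 * Complex.I)) z

/-- The tangent vector to `Ξ₀` at the point with polar coordinates `q` whose components with
respect to `(∂/∂a, ∂/∂ϑ)` are `v`. -/
def polarTangent (q v : ℝ × ℝ) (z : ℂ) : ℂ :=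
  fderiv ℝ (fun q' : ℝ × ℝ => polarLump q' z) q v

/-- `I(a) = 4 ∫_{-π}^{π} ∫_{-∞}^{∞} |sech z|² / (1 + a² |sech z|²)² dx dy`, where `z = x + iy`. -/
def conformalFactor (a : ℝ) : ℝ :=
  4 * ∫ y in (-Real.pi)..Real.pi, ∫ x : ℝ,
    ‖(Complex.cosh (x + y * Complex.I))⁻¹‖ ^ 2 /
      (1 + a ^ 2 * ‖(Complex.cosh (x + y * Complex.I))⁻¹‖ ^ 2) ^ 2

end CylinderLump

end

open CylinderLump

namespace CylinderLump

/-! ### Substitution in integrals of nonnegative functions -/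

/-! Both halves of the theorem reduce to the single integral `∫₁^∞ π / √((c² - 1)((c + 2t)² - 1))
dc`.

For `f`: substituting `k ↦ 1/k` in the second summand turns `f(t)` into `∫₀^∞ J(k)/(k + t) dk`,
where `J(k)` is the period of a quartic with roots `±(1 - k)`, `±(1 + k)`, equal to `K(k)` for `k <
1` and to `K(1/k)/k` for `k > 1` (`lintegral_quartic`). After the shift `c = w + k` the quartic
becomes `(c² - 1)(1 - (c - 2k)²)`, so Tonelli allows integrating over `k` first, and that integral
is elementary (`lintegral_section_cos`). The remaining integral over `c` becomes Gauss's integral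
`G(t) = agmIntegral t` by two substitutions through a hyperbolic parameter, whence `f = (π/2) G`
(`kernelIntegral_eq`). Legendre's forms of `G` give the closed formulas. Everything is carried out
for nonnegative functions with values in `[0, ∞]`, so convergence follows from the finite value.

For the metric: with `C = |cosh z|²` and `b = a²`, the density is `C/(C + b)² = d/db (b/(C + b))`.
Integrating `1/(C + b)` over `y` and putting `c = cosh 2x` yields the same integral over `c`, so its
total is `4 f(b)`. Thus `I(a) = 16 (b f)'(b)`. An integration by parts gives `(t G)' = ∫ sin² φ / Δ`
with `Δ = agmDelta t φ`, and `(t² - 1) ∫ sin² φ / Δ = ∫ Δ - G`, which are the formulas with `E` and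
`K`; at `t = 1` the middle integral is directly `π/4`.

Analyticity comes from the holomorphic extension of `f` to the right half-plane. -/

lemma lintegral_ofReal_subst {s t : Set ℝ} {f f' g h : ℝ → ℝ} (hs : MeasurableSet s)
    (hf : ∀ x ∈ s, HasDerivAt f (f' x) x) (hb : BijOn f s t)
    (hgh : ∀ x ∈ s, |f' x| * g (f x) = h x) :
    ∫⁻ y in t, ENNReal.ofReal (g y) = ∫⁻ x in s, ENNReal.ofReal (h x) := by
  rw [← hb.image_eq, lintegral_image_eq_lintegral_abs_deriv_mul hs
    (fun x hx => (hf x hx).hasDerivWithinAt) hb.injOn]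
  refine setLIntegral_congr_fun hs fun x hx => ?_
  rw [← ENNReal.ofReal_mul (abs_nonneg _), hgh x hx]

lemma bijOn_Ioo_of_deriv_neg {a b : ℝ} {f f' : ℝ → ℝ} (hab : a ≤ b)
    (hc : ContinuousOn f (Icc a b)) (hd : ∀ x ∈ Ioo a b, HasDerivAt f (f' x) x)
    (hneg : ∀ x ∈ Ioo a b, f' x < 0) : BijOn f (Ioo a b) (Ioo (f b) (f a)) := by
  have hanti : StrictAntiOn f (Icc a b) := by
    refine strictAntiOn_of_deriv_neg (convex_Icc a b) hc fun x hx => ?_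
    rw [interior_Icc] at hx
    rw [(hd x hx).deriv]
    exact hneg x hx
  refine ⟨fun x hx => ⟨?_, ?_⟩, hanti.injOn.mono Ioo_subset_Icc_self,
    intermediate_value_Ioo' hab hc⟩
  · exact hanti (Ioo_subset_Icc_self hx) (right_mem_Icc.2 hab) hx.2
  · exact hanti (left_mem_Icc.2 hab) (Ioo_subset_Icc_self hx) hx.1

lemma lintegral_even {f : ℝ → ENNReal} (hf : ∀ x, f (-x) = f x) :
    ∫⁻ x, f x = 2 * ∫⁻ x in Ioi 0, f x := by
  have h1 : ∫⁻ x in Iio 0, f x = ∫⁻ x in Ioi 0, f x := by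
    have := (Measure.measurePreserving_neg (volume : Measure ℝ)).setLIntegral_comp_preimage_emb
      (MeasurableEquiv.neg ℝ).measurableEmbedding f (Iio 0)
    rw [← this]
    simp [hf]
  rw [← lintegral_add_compl f (measurableSet_Ioi (a := (0 : ℝ))), compl_Ioi,
    setLIntegral_congr Iio_ae_eq_Iic.symm, h1, two_mul]

lemma lintegral_Ioo_ofReal {a b : ℝ} {f : ℝ → ℝ} (hab : a ≤ b) (hf : ContinuousOn f (Icc a b))
    (h0 : ∀ x, 0 ≤ f x) :
    ∫⁻ x in Ioo a b, ENNReal.ofReal (f x) = ENNReal.ofReal (∫ x in a..b, f x) := by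
  rw [intervalIntegral.integral_of_le hab, ofReal_integral_eq_lintegral_ofReal
    (hf.integrableOn_Icc.mono_set Ioc_subset_Icc_self) (Eventually.of_forall h0),
    setLIntegral_congr Ioo_ae_eq_Ioc]

lemma integral_zero_pi_of_symm {f : ℝ → ℝ} (hf : Continuous f)
    (hs : ∀ x, f (Real.pi - x) = f x) :
    ∫ x in (0 : ℝ)..Real.pi, f x = 2 * ∫ x in (0 : ℝ)..(Real.pi / 2), f x := by
  have h : ∫ x in (Real.pi / 2)..Real.pi, f x = ∫ x in (0 : ℝ)..(Real.pi / 2), f x := by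
    have := intervalIntegral.integral_comp_sub_left (a := 0) (b := Real.pi / 2) f Real.pi
    simp only [hs] at this
    rw [this]; congr 1 <;> ring
  rw [← intervalIntegral.integral_add_adjacent_intervals (hf.intervalIntegrable 0 (Real.pi / 2))
    (hf.intervalIntegrable _ _), h]
  ring

/-! ### The integral of `1 / (m + cos y)` -/

lemma integral_inv_add_cos {m : ℝ} (hm : 1 < m) (a b : ℝ) (ha : Real.sin a = 0)
    (hb : Real.sin b = 0) :
    ∫ y in a..b, 1 / (m + Real.cos y) = (b - a) / √(m ^ 2 - 1) := by
  set r := √(m ^ 2 - 1) with hr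
  have hr2 : r ^ 2 = m ^ 2 - 1 := Real.sq_sqrt (by nlinarith)
  have hr0 : 0 < r := Real.sqrt_pos.2 (by nlinarith)
  have hmc : ∀ y, 0 < m + Real.cos y := fun y => by linarith [Real.neg_one_le_cos y]
  -- This antiderivative is smooth on the whole line, unlike the one in `tan (y/2)`, so the interval
  -- may span several periods; the arctangent vanishes at both ends because the sine does.
  have hd : ∀ y ∈ uIcc a b, HasDerivAt
      (fun y => (y - 2 * Real.arctan (Real.sin y / (m + r + Real.cos y))) / r)
      (1 / (m + Real.cos y)) y := by
    intro y _
    have hq : 0 < m + r + Real.cos y := by linarith [hmc y]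
    have h1 : HasDerivAt (fun y => Real.sin y / (m + r + Real.cos y)) _ y :=
      (Real.hasDerivAt_sin y).div ((Real.hasDerivAt_cos y).const_add (m + r)) hq.ne'
    have h2 := (((hasDerivAt_id y).sub (h1.arctan.const_mul 2)).div_const r)
    refine h2.congr_deriv ?_
    have hsc := Real.sin_sq_add_cos_sq y
    have hden : (m + r + Real.cos y) ^ 2 + Real.sin y ^ 2 =
        2 * (m + r) * (m + Real.cos y) := by
      linear_combination hsc + hr2
    have e1 : 1 + (Real.sin y / (m + r + Real.cos y)) ^ 2 =
        2 * (m + r) * (m + Real.cos y) / (m + r + Real.cos y) ^ 2 := by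
      rw [← hden]; field_simp
    have hmr : 0 < m + r := by linarith
    have := hmc y
    rw [e1]
    field_simp
    linear_combination -hsc - hr2
  rw [intervalIntegral.integral_eq_sub_of_hasDerivAt hd
    ((continuous_const.div (continuous_const.add Real.continuous_cos)
      fun y => (hmc y).ne').intervalIntegrable _ _), ha, hb]
  simp only [zero_div, Real.arctan_zero]
  ring

/-! ### Elliptic integrals between the roots of a quartic -/

/-- Substitute for `w` the third side of a triangle with sides `p`, `q` and angle `φ` between `q`
and `w`: `p² = w² + q² - 2qw cos φ`. As `φ` runs over `(0, π)`, `w` decreases from `p + q` to `p -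
q`, the quartic becomes the square `(2qw sin φ)²`, and `dw` cancels all of it except `2 √(p² - q²
sin² φ)`. -/
lemma lintegral_quartic {p q : ℝ} (hq : 0 < q) (hqp : q < p) :
    ∫⁻ w in Ioo (p - q) (p + q),
        ENNReal.ofReal (1 / √((w ^ 2 - (p - q) ^ 2) * ((p + q) ^ 2 - w ^ 2))) =
      ENNReal.ofReal (ellipticK (q / p) / p) := by
  have hp : 0 < p := hq.trans hqp
  set r : ℝ → ℝ := fun φ => √(p ^ 2 - q ^ 2 * Real.sin φ ^ 2) with hrdef
  have hpos : ∀ φ, 0 < p ^ 2 - q ^ 2 * Real.sin φ ^ 2 := fun φ => by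
    nlinarith [Real.sin_sq_le_one φ, sq_nonneg q]
  have hr0 : ∀ φ, 0 < r φ := fun φ => Real.sqrt_pos.2 (hpos φ)
  have hr2 : ∀ φ, r φ ^ 2 = p ^ 2 - q ^ 2 * Real.sin φ ^ 2 := fun φ => Real.sq_sqrt (hpos φ).le
  have hrc : Continuous r := by fun_prop
  set w : ℝ → ℝ := fun φ => q * Real.cos φ + r φ with hw
  have hw0 : ∀ φ, 0 < w φ := fun φ => by
    have : -(q * Real.cos φ) < r φ := by
      refine lt_of_le_of_lt (le_abs_self _) (abs_lt_of_sq_lt_sq ?_ (hr0 φ).le)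
      rw [hr2]; nlinarith [Real.sin_sq_add_cos_sq φ]
    simp only [hw]; linarith
  have hd : ∀ φ, HasDerivAt w (-(q * Real.sin φ * w φ / r φ)) φ := by
    intro φ
    have h1 := ((((Real.hasDerivAt_sin φ).pow 2).const_mul (q ^ 2)).const_sub (p ^ 2)).sqrt
      (hpos φ).ne'
    refine (((Real.hasDerivAt_cos φ).const_mul q).add h1).congr_deriv ?_
    have := (hr0 φ).ne'
    change q * -Real.sin φ + _ / (2 * r φ) = -(q * Real.sin φ * (q * Real.cos φ + r φ) / r φ)
    field_simp
    push_cast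
    ring
  have hsin : ∀ φ ∈ Ioo 0 Real.pi, 0 < Real.sin φ := fun φ hφ => Real.sin_pos_of_mem_Ioo hφ
  have hb := bijOn_Ioo_of_deriv_neg Real.pi_pos.le (by fun_prop : Continuous w).continuousOn
    (fun φ _ => hd φ) (fun φ hφ => by
      have := hsin φ hφ
      have := hw0 φ
      have := hr0 φ
      rw [neg_lt_zero]; positivity)
  have hw1 : w Real.pi = p - q := by simp [hw, hrdef, Real.sqrt_sq hp.le]; ring
  have hw2 : w 0 = p + q := by simp [hw, hrdef, Real.sqrt_sq hp.le]; ring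
  rw [hw1, hw2] at hb
  rw [lintegral_ofReal_subst (h := fun φ => 1 / (2 * r φ)) measurableSet_Ioo (fun φ _ => hd φ) hb]
  · have hc : Continuous fun φ => 1 / (2 * r φ) :=
      continuous_const.div (by fun_prop) fun φ => (mul_pos two_pos (hr0 φ)).ne'
    rw [lintegral_Ioo_ofReal Real.pi_pos.le hc.continuousOn
      (fun φ => (one_div_pos.2 (mul_pos two_pos (hr0 φ))).le),
      integral_zero_pi_of_symm hc (fun φ => by simp [hrdef]), ellipticK,
      ← intervalIntegral.integral_const_mul, ← intervalIntegral.integral_div]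
    congr 2 with φ
    have : r φ = p * √(1 - (q / p) ^ 2 * Real.sin φ ^ 2) := by
      rw [hrdef, ← Real.sqrt_sq hp.le, ← Real.sqrt_mul (sq_nonneg p), Real.sqrt_sq hp.le]
      field_simp
    rw [this]
    have := hr0 φ
    field_simp
  · intro φ hφ
    have h1 := hsin φ hφ
    have h2 := hw0 φ
    have h3 := hr0 φ
    have h4 : (w φ ^ 2 - (p - q) ^ 2) * ((p + q) ^ 2 - w φ ^ 2) =
        (2 * q * w φ * Real.sin φ) ^ 2 := by
      have hsc := Real.sin_sq_add_cos_sq φ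
      have hwr : w φ ^ 2 = 2 * q * Real.cos φ * w φ + p ^ 2 - q ^ 2 := by
        simp only [hw]
        linear_combination hr2 φ - q ^ 2 * hsc
      have : w φ ^ 2 - p ^ 2 - q ^ 2 = 2 * q * (Real.cos φ * w φ - q) := by
        linear_combination hwr
      linear_combination (-(w φ ^ 2 - p ^ 2 - q ^ 2) - 2 * q * (Real.cos φ * w φ - q)) * this
        - 4 * q ^ 2 * hwr - 4 * q ^ 2 * w φ ^ 2 * hsc
    rw [h4, Real.sqrt_sq (by positivity), abs_neg, abs_of_pos (by positivity)]
    field_simp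

/-! ### Reduction of `f` to a single elliptic integral -/

lemma measurable_ellipticK : Measurable ellipticK := by
  have : StronglyMeasurable fun k : ℝ => ∫ φ in Ioc 0 (Real.pi / 2),
      1 / √(1 - k ^ 2 * Real.sin φ ^ 2) := by
    refine StronglyMeasurable.integral_prod_right (f := fun k φ : ℝ =>
      1 / √(1 - k ^ 2 * Real.sin φ ^ 2)) (Measurable.stronglyMeasurable ?_)
    unfold Function.uncurry
    fun_prop
  unfold ellipticK
  simp_rw [intervalIntegral.integral_of_le Real.pi_div_two_pos.le]
  exact this.measurable

lemma ellipticK_nonneg (k : ℝ) : 0 ≤ ellipticK k :=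
  intervalIntegral.integral_nonneg Real.pi_div_two_pos.le fun _ _ => by positivity

/-- The section over `k` of the region of integration in the variables `(k, c)`. -/
def kernelSection (k : ℝ) : Set ℝ := {c | 1 < c ∧ |c - 2 * k| < 1}

lemma measurableSet_kernelSection (k : ℝ) : MeasurableSet (kernelSection k) := by
  apply IsOpen.measurableSet
  exact (isOpen_lt continuous_const continuous_id).inter
    (isOpen_lt (f := fun c : ℝ => |c - 2 * k|) (g := fun _ => 1) (by fun_prop) (by fun_prop))

lemma lintegral_kernelSection_eq (k : ℝ) :
    ∫⁻ w in Ioo |1 - k| (1 + k),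
        ENNReal.ofReal (1 / √((w ^ 2 - (1 - k) ^ 2) * ((1 + k) ^ 2 - w ^ 2))) =
      ∫⁻ c in kernelSection k,
        ENNReal.ofReal (1 / √((c ^ 2 - 1) * (1 - (c - 2 * k) ^ 2))) := by
  refine lintegral_ofReal_subst (f := fun c => c - k) (f' := fun _ => 1)
    (measurableSet_kernelSection k) (fun x _ => (hasDerivAt_id x).sub_const k)
    ⟨?_, fun x _ y _ h => by simpa using h, ?_⟩ ?_
  · rintro c ⟨h1, h2⟩
    rw [abs_lt] at h2
    exact ⟨abs_lt.2 ⟨by linarith, by linarith⟩, by linarith⟩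
  · rintro w ⟨h1, h2⟩
    rw [abs_lt] at h1
    exact ⟨w + k, ⟨by linarith, abs_lt.2 ⟨by linarith, by linarith⟩⟩, by simp⟩
  · intro c _
    rw [abs_one, one_mul, show ((c - k) ^ 2 - (1 - k) ^ 2) * ((1 + k) ^ 2 - (c - k) ^ 2) =
      (c ^ 2 - 1) * (1 - (c - 2 * k) ^ 2) by ring]

lemma lintegral_kernelSection_of_lt_one {k : ℝ} (h0 : 0 < k) (h1 : k < 1) :
    ∫⁻ c in kernelSection k,
        ENNReal.ofReal (1 / √((c ^ 2 - 1) * (1 - (c - 2 * k) ^ 2))) =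
      ENNReal.ofReal (ellipticK k) := by
  rw [← lintegral_kernelSection_eq, abs_of_pos (by linarith), lintegral_quartic h0 h1]
  simp

lemma lintegral_kernelSection_of_one_lt {k : ℝ} (h1 : 1 < k) :
    ∫⁻ c in kernelSection k,
        ENNReal.ofReal (1 / √((c ^ 2 - 1) * (1 - (c - 2 * k) ^ 2))) =
      ENNReal.ofReal (ellipticK (1 / k) / k) := by
  rw [← lintegral_kernelSection_eq, abs_of_neg (by linarith), ← lintegral_quartic one_pos h1]
  rw [show -(1 - k) = k - 1 by ring, show 1 + k = k + 1 by ring,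
    show (1 - k) ^ 2 = (k - 1) ^ 2 by ring]

/-- The two summands of the kernel are the contributions of `k < 1` and `k > 1`: inversion `k ↦ 1/k`
carries `K(1/k) / (k (k + t))` on `(1, ∞)` to `K(k) / (1 + tk)` on `(0, 1)`. -/
lemma lintegral_kernelIntegrand {t : ℝ} (ht : 0 < t) :
    ∫⁻ k in Ioo 0 1, ENNReal.ofReal (kernelIntegrand t k) =
      ∫⁻ k in Ioi 0, ENNReal.ofReal (1 / (k + t)) *
        ∫⁻ c in kernelSection k,
          ENNReal.ofReal (1 / √((c ^ 2 - 1) * (1 - (c - 2 * k) ^ 2))) := by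
  have hmeas := measurable_ellipticK
  have hunion : Ioi (0 : ℝ) = Ioo 0 1 ∪ Ici 1 := (Ioo_union_Ici_eq_Ioi one_pos).symm
  set Φ : ℝ → ENNReal := fun k => ENNReal.ofReal (1 / (k + t)) *
    ∫⁻ c in kernelSection k, ENNReal.ofReal (1 / √((c ^ 2 - 1) * (1 - (c - 2 * k) ^ 2)))
  have h1 : ∫⁻ k in Ioo 0 1, Φ k = ∫⁻ k in Ioo 0 1, ENNReal.ofReal (1 / (k + t) * ellipticK k) := by
    refine setLIntegral_congr_fun measurableSet_Ioo fun k hk => ?_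
    have := hk.1
    rw [ENNReal.ofReal_mul (by positivity), ← lintegral_kernelSection_of_lt_one hk.1 hk.2]
  have h2 : ∫⁻ k in Ioi 1, Φ k =
      ∫⁻ k in Ioi 1, ENNReal.ofReal (1 / (k + t) * (ellipticK (1 / k) / k)) := by
    refine setLIntegral_congr_fun measurableSet_Ioi fun k hk => ?_
    have : (0 : ℝ) < k := one_pos.trans hk
    rw [ENNReal.ofReal_mul (by positivity), ← lintegral_kernelSection_of_one_lt hk]
  -- The point `k = 1`, where the two roots `±(1 - k)` collide, is discarded as a null set.
  rw [hunion, lintegral_union measurableSet_Ici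
    (disjoint_left.2 fun x hx hx' => not_lt.2 hx' hx.2), setLIntegral_congr Ioi_ae_eq_Ici.symm,
    h1, h2,
    lintegral_ofReal_subst (s := Ioo 0 1) (t := Ioi 1) (f := fun k => k⁻¹)
      (f' := fun k => -(k ^ 2)⁻¹) (h := fun k => 1 / (1 + t * k) * ellipticK k) measurableSet_Ioo
      (fun k hk => hasDerivAt_inv hk.1.ne') ?_ ?_, ← lintegral_add_left (by fun_prop)]
  · refine setLIntegral_congr_fun measurableSet_Ioo fun k hk => ?_
    have := ellipticK_nonneg k
    have := hk.1
    rw [← ENNReal.ofReal_add (by positivity) (by positivity), kernelIntegrand, add_mul]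
  · refine ⟨fun k hk => (one_lt_inv₀ hk.1).2 hk.2, inv_injective.injOn, fun k hk => ?_⟩
    have hk' : (1 : ℝ) < k := hk
    exact ⟨k⁻¹, ⟨by positivity, inv_lt_one_of_one_lt₀ hk'⟩, inv_inv k⟩
  · intro k hk
    have := hk.1
    rw [abs_neg, abs_of_pos (by positivity), one_div k⁻¹, inv_inv]
    have : 0 < 1 + t * k := by positivity
    have h : k⁻¹ + t = (1 + t * k) / k := by field_simp
    rw [h]
    field_simp

/-- With `k = (c + cos y)/2` the factor `√(1 - (c - 2k)²)` becomes `sin y` and cancels the Jacobian,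
leaving the integral of `1/(m + cos y)` with `m = c + 2t`. -/
lemma lintegral_section_cos {t c : ℝ} (ht : 0 < t) (hc : 1 < c) :
    ∫⁻ k in Ioo ((c - 1) / 2) ((c + 1) / 2),
        ENNReal.ofReal (1 / (k + t) * (1 / √((c ^ 2 - 1) * (1 - (c - 2 * k) ^ 2)))) =
      ENNReal.ofReal (Real.pi / √((c ^ 2 - 1) * ((c + 2 * t) ^ 2 - 1))) := by
  have hb : BijOn (fun y => (c + Real.cos y) / 2) (Ioo 0 Real.pi)
      (Ioo ((c - 1) / 2) ((c + 1) / 2)) := by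
    have := bijOn_Ioo_of_deriv_neg (f := fun y => (c + Real.cos y) / 2) Real.pi_pos.le
      (by fun_prop) (fun y _ => ((Real.hasDerivAt_cos y).const_add c).div_const 2)
      (fun y hy => by have := Real.sin_pos_of_mem_Ioo hy; linarith)
    simpa [sub_eq_add_neg] using this
  have hm : ∀ y, 0 < c + 2 * t + Real.cos y := fun y => by linarith [Real.neg_one_le_cos y]
  have hcc : 0 < c ^ 2 - 1 := by nlinarith
  have hcont : Continuous fun y => 1 / √(c ^ 2 - 1) * (1 / (c + 2 * t + Real.cos y)) :=
    continuous_const.mul (continuous_const.div (by fun_prop) fun y => (hm y).ne')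
  rw [lintegral_ofReal_subst (h := fun y => 1 / √(c ^ 2 - 1) * (1 / (c + 2 * t + Real.cos y)))
    measurableSet_Ioo (fun y _ => ((Real.hasDerivAt_cos y).const_add c).div_const 2) hb,
    lintegral_Ioo_ofReal Real.pi_pos.le
      hcont.continuousOn (fun y => by have := hm y; positivity),
    intervalIntegral.integral_const_mul, integral_inv_add_cos (by linarith) _ _ (by simp)
      (by simp), Real.sqrt_mul hcc.le]
  · congr 1; ring
  · intro y hy
    have h1 := Real.sin_pos_of_mem_Ioo hy
    have h2 : (c ^ 2 - 1) * (1 - (c - 2 * ((c + Real.cos y) / 2)) ^ 2) =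
        (c ^ 2 - 1) * Real.sin y ^ 2 := by
      rw [Real.sin_sq]; ring
    have h3 := hm y
    have h4 : (c + Real.cos y) / 2 + t = (c + 2 * t + Real.cos y) / 2 := by ring
    have h5 := Real.sqrt_pos.2 hcc
    rw [h2, Real.sqrt_mul hcc.le, Real.sqrt_sq h1.le, abs_of_neg (by linarith), h4]
    field_simp

lemma lintegral_kernelIntegrand_eq_quartic {t : ℝ} (ht : 0 < t) :
    ∫⁻ k in Ioo 0 1, ENNReal.ofReal (kernelIntegrand t k) =
      ∫⁻ c in Ioi 1, ENNReal.ofReal (Real.pi / √((c ^ 2 - 1) * ((c + 2 * t) ^ 2 - 1))) := by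
  let S : Set (ℝ × ℝ) := {p | 1 < p.2 ∧ |p.2 - 2 * p.1| < 1}
  have hS : MeasurableSet S := by
    apply IsOpen.measurableSet
    exact (isOpen_lt continuous_const continuous_snd).inter
      (isOpen_lt (f := fun p : ℝ × ℝ => |p.2 - 2 * p.1|) (g := fun _ => 1) (by fun_prop)
        (by fun_prop))
  -- Extending by zero outside the region turns both iterated integrals into sections of one
  -- measurable function on the plane, to which Tonelli applies.
  let F : ℝ × ℝ → ENNReal := S.indicator fun p =>
    ENNReal.ofReal (1 / (p.1 + t) * (1 / √((p.2 ^ 2 - 1) * (1 - (p.2 - 2 * p.1) ^ 2))))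
  have hF1 : ∀ p ∈ S, F p = _ := fun p hp => indicator_of_mem hp _
  have hF0 : ∀ p ∉ S, F p = 0 := fun p hp => indicator_of_notMem hp _
  have hF : Measurable F := Measurable.indicator (by fun_prop) hS
  have h1 : ∀ k ∈ Ioi (0 : ℝ), ENNReal.ofReal (1 / (k + t)) * ∫⁻ c in kernelSection k,
      ENNReal.ofReal (1 / √((c ^ 2 - 1) * (1 - (c - 2 * k) ^ 2))) = ∫⁻ c, F (k, c) := by
    intro k hk
    have hk' : (0 : ℝ) < k := hk
    rw [← lintegral_const_mul _ (by fun_prop),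
      ← lintegral_indicator (measurableSet_kernelSection k)]
    refine lintegral_congr fun c => ?_
    by_cases hc : c ∈ kernelSection k
    · rw [indicator_of_mem hc, ← ENNReal.ofReal_mul (by positivity)]
      exact (hF1 (k, c) hc).symm
    · rw [indicator_of_notMem hc]
      exact (hF0 (k, c) hc).symm
  rw [lintegral_kernelIntegrand ht, setLIntegral_congr_fun measurableSet_Ioi h1,
    lintegral_lintegral_swap (f := fun k c => F (k, c)) hF.aemeasurable,
    ← lintegral_indicator measurableSet_Ioi]
  refine lintegral_congr fun c => ?_
  by_cases hc : 1 < c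
  · rw [indicator_of_mem (show c ∈ Ioi 1 from hc), ← lintegral_section_cos ht hc,
      ← lintegral_indicator measurableSet_Ioi, ← lintegral_indicator measurableSet_Ioo]
    refine lintegral_congr fun k => ?_
    by_cases hk : k ∈ Ioo ((c - 1) / 2) ((c + 1) / 2)
    · rw [indicator_of_mem hk, indicator_of_mem (show k ∈ Ioi 0 by
        have := hk.1; rw [mem_Ioi]; linarith)]
      exact hF1 (k, c) ⟨hc, abs_lt.2 ⟨by linarith [hk.2], by linarith [hk.1]⟩⟩
    · rw [indicator_of_notMem hk, indicator_apply_eq_zero]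
      refine fun _ => hF0 (k, c) (fun h => hk ?_)
      have := abs_lt.1 h.2
      exact ⟨by linarith, by linarith⟩
  · rw [indicator_of_notMem (show c ∉ Ioi 1 from hc)]
    refine (lintegral_congr fun k => ?_).trans lintegral_zero
    exact hF0 (k, c) fun h => hc h.1

/-! ### The closed form of `f` -/

/-- `√(cos² φ + t² sin² φ)`. -/
noncomputable def agmDelta (t φ : ℝ) : ℝ := √(Real.cos φ ^ 2 + t ^ 2 * Real.sin φ ^ 2)

/-- Gauss's integral `∫₀^{π/2} dφ / √(cos² φ + t² sin² φ)`. -/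
noncomputable def agmIntegral (t : ℝ) : ℝ := ∫ φ in (0 : ℝ)..(Real.pi / 2), 1 / agmDelta t φ

lemma cos_sq_add_sin_sq_pos {t : ℝ} (ht : 0 < t) (φ : ℝ) :
    0 < Real.cos φ ^ 2 + t ^ 2 * Real.sin φ ^ 2 := by
  rcases eq_or_ne (Real.sin φ) 0 with h | h
  · have := Real.sin_sq_add_cos_sq φ
    rw [h] at this ⊢
    nlinarith
  · positivity

lemma agmDelta_pos {t : ℝ} (ht : 0 < t) (φ : ℝ) : 0 < agmDelta t φ :=
  Real.sqrt_pos.2 (cos_sq_add_sin_sq_pos ht φ)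

lemma agmDelta_sq {t : ℝ} (ht : 0 < t) (φ : ℝ) :
    agmDelta t φ ^ 2 = Real.cos φ ^ 2 + t ^ 2 * Real.sin φ ^ 2 :=
  Real.sq_sqrt (cos_sq_add_sin_sq_pos ht φ).le

@[fun_prop]
lemma continuous_agmDelta (t : ℝ) : Continuous (agmDelta t) := by
  unfold agmDelta; fun_prop

lemma continuous_inv_agmDelta {t : ℝ} (ht : 0 < t) : Continuous fun φ => 1 / agmDelta t φ :=
  continuous_const.div (by fun_prop) fun φ => (agmDelta_pos ht φ).ne'

lemma agmIntegral_nonneg (t : ℝ) : 0 ≤ agmIntegral t :=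
  intervalIntegral.integral_nonneg Real.pi_div_two_pos.le fun _ _ =>
    one_div_nonneg.2 (Real.sqrt_nonneg _)

/-- Centre the quartic with `h = c + t`: its roots become `±(1 + t)`, `±(1 - t)`, and `h² = 1 + t² +
2t cosh η` makes it the perfect square `(2t sinh η)²`. -/
lemma lintegral_quartic_eq_cosh {t : ℝ} (ht : 0 < t) :
    ∫⁻ c in Ioi 1, ENNReal.ofReal (Real.pi / √((c ^ 2 - 1) * ((c + 2 * t) ^ 2 - 1))) =
      ∫⁻ η in Ioi 0, ENNReal.ofReal (Real.pi * (1 / (2 * √(1 + t ^ 2 + 2 * t * Real.cosh η)))) := by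
  have hpos : ∀ η, 0 < 1 + t ^ 2 + 2 * t * Real.cosh η := fun η => by
    have := Real.cosh_pos η; positivity
  refine lintegral_ofReal_subst (f := fun η => √(1 + t ^ 2 + 2 * t * Real.cosh η) - t)
    measurableSet_Ioi (fun η _ => ((((Real.hasDerivAt_cosh η).const_mul (2 * t)).const_add
      (1 + t ^ 2)).sqrt (hpos η).ne').sub_const t) ⟨?_, ?_, ?_⟩ ?_
  · intro η hη
    have h1 : 1 < Real.cosh η := Real.one_lt_cosh.2 (ne_of_gt hη)
    have : 1 + t < √(1 + t ^ 2 + 2 * t * Real.cosh η) := Real.lt_sqrt_of_sq_lt (by nlinarith)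
    rw [mem_Ioi]; linarith
  · intro x hx y hy h
    have h1 := (Real.sqrt_inj (hpos x).le (hpos y).le).1 (sub_left_injective h)
    refine Real.cosh_injOn (mem_Ici_of_Ioi hx) (mem_Ici_of_Ioi hy) ?_
    exact mul_left_cancel₀ (mul_pos two_pos ht).ne' (add_left_cancel h1)
  · intro c hc
    have hc' : 1 < c := hc
    have h1 : 1 < ((c + t) ^ 2 - 1 - t ^ 2) / (2 * t) := by
      rw [lt_div_iff₀ (by positivity)]; nlinarith
    refine ⟨Real.arcosh (((c + t) ^ 2 - 1 - t ^ 2) / (2 * t)), Real.arcosh_pos h1, ?_⟩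
    simp only [Real.cosh_arcosh h1.le]
    rw [mul_div_cancel₀ _ (by positivity), show 1 + t ^ 2 + ((c + t) ^ 2 - 1 - t ^ 2) = (c + t) ^ 2 by ring,
      Real.sqrt_sq (by linarith)]
    ring
  · intro η hη
    have hs : 0 < Real.sinh η := Real.sinh_pos_iff.2 hη
    set h := √(1 + t ^ 2 + 2 * t * Real.cosh η) with hdef
    have h0 : 0 < h := Real.sqrt_pos.2 (hpos η)
    have h2 : h ^ 2 = 1 + t ^ 2 + 2 * t * Real.cosh η := Real.sq_sqrt (hpos η).le
    have e : ((h - t) ^ 2 - 1) * ((h - t + 2 * t) ^ 2 - 1) = (2 * t * Real.sinh η) ^ 2 := by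
      have e1 : ((h - t) ^ 2 - 1) * ((h - t + 2 * t) ^ 2 - 1) =
          (h ^ 2 - (1 + t) ^ 2) * (h ^ 2 - (1 - t) ^ 2) := by ring
      rw [e1, h2]
      linear_combination 4 * t ^ 2 * Real.cosh_sq η
    rw [e, Real.sqrt_sq (by positivity), abs_of_pos (by positivity)]
    field_simp

/-- The substitution is `tan φ = e^{η/2} / √t`; the factor `√t` is what makes the result symmetric
in `η`. -/
lemma lintegral_agmDelta_eq_cosh {t : ℝ} (ht : 0 < t) :
    ∫⁻ φ in Ioo 0 (Real.pi / 2), ENNReal.ofReal (1 / agmDelta t φ) =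
      ∫⁻ η, ENNReal.ofReal (1 / (2 * √(1 + t ^ 2 + 2 * t * Real.cosh η))) := by
  set X : ℝ → ℝ := fun η => Real.exp ((η - Real.log t) / 2) with hX
  have hX0 : ∀ η, 0 < X η := fun η => Real.exp_pos _
  have hX2 : ∀ η, X η ^ 2 = Real.exp η / t := fun η => by
    rw [hX, ← Real.exp_nat_mul]
    push_cast
    rw [mul_div_cancel₀ _ two_ne_zero, Real.exp_sub, Real.exp_log ht]
  have hd : ∀ η, HasDerivAt X (X η / 2) η := fun η =>
    ((((hasDerivAt_id η).sub_const (Real.log t)).div_const 2).exp).congr_deriv (by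
      simp only [hX, id]; ring)
  rw [← setLIntegral_univ (f := fun η =>
    ENNReal.ofReal (1 / (2 * √(1 + t ^ 2 + 2 * t * Real.cosh η))))]
  refine lintegral_ofReal_subst (f := fun η => Real.arctan (X η)) MeasurableSet.univ
    (fun η _ => (hd η).arctan) ⟨?_, ?_, ?_⟩ ?_
  · exact fun η _ => ⟨Real.arctan_pos.2 (hX0 η), Real.arctan_lt_pi_div_two _⟩
  · intro x _ y _ h
    have := Real.exp_injective (Real.arctan_injective h)
    linarith
  · intro φ hφ
    have h1 := Real.tan_pos_of_pos_of_lt_pi_div_two hφ.1 hφ.2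
    refine ⟨2 * Real.log (Real.tan φ) + Real.log t, mem_univ _, ?_⟩
    simp only [hX]
    rw [add_sub_cancel_right, mul_div_cancel_left₀ _ two_ne_zero, Real.exp_log h1,
      Real.arctan_tan (by linarith [hφ.1, Real.pi_pos]) hφ.2]
  · intro η _
    have h0 := hX0 η
    have e1 : Real.cos (Real.arctan (X η)) ^ 2 + t ^ 2 * Real.sin (Real.arctan (X η)) ^ 2 =
        (1 + t ^ 2 * X η ^ 2) / (1 + X η ^ 2) := by
      rw [Real.sin_sq, Real.cos_sq_arctan]
      field_simp
      ring
    have e2 : 1 + t ^ 2 + 2 * t * Real.cosh η =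
        (1 + t ^ 2 * X η ^ 2) / (1 + X η ^ 2) * ((1 + X η ^ 2) / X η) ^ 2 := by
      have : (1 + t ^ 2 * X η ^ 2) / (1 + X η ^ 2) * ((1 + X η ^ 2) / X η) ^ 2 =
          (1 + t ^ 2 * X η ^ 2) * (1 + X η ^ 2) / X η ^ 2 := by field_simp
      rw [this, hX2, Real.cosh_eq, Real.exp_neg]
      have := Real.exp_pos η
      field_simp
      ring
    have e3 : 0 < √((1 + t ^ 2 * X η ^ 2) / (1 + X η ^ 2)) := Real.sqrt_pos.2 (by positivity)
    rw [agmDelta, e1, e2, Real.sqrt_mul (by positivity), Real.sqrt_sq (by positivity),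
      abs_of_pos (by positivity)]
    field_simp

lemma lintegral_kernelIntegrand_eq_agm {t : ℝ} (ht : 0 < t) :
    ∫⁻ k in Ioo 0 1, ENNReal.ofReal (kernelIntegrand t k) =
      ENNReal.ofReal (Real.pi / 2 * agmIntegral t) := by
  have h1 := lintegral_agmDelta_eq_cosh ht
  rw [lintegral_even (fun x => by simp), lintegral_Ioo_ofReal Real.pi_div_two_pos.le
    (continuous_inv_agmDelta ht).continuousOn
    (fun φ => (one_div_pos.2 (agmDelta_pos ht φ)).le)] at h1
  have h2 : ENNReal.ofReal Real.pi = ENNReal.ofReal (Real.pi / 2) * 2 := by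
    rw [← ENNReal.ofReal_ofNat 2, ← ENNReal.ofReal_mul (by positivity),
      div_mul_cancel₀ _ two_ne_zero]
  simp_rw [lintegral_kernelIntegrand_eq_quartic ht, lintegral_quartic_eq_cosh ht,
    ENNReal.ofReal_mul Real.pi_pos.le]
  rw [lintegral_const_mul _ (by fun_prop), h2, mul_assoc, ← h1,
    ENNReal.ofReal_mul (by positivity), agmIntegral]

lemma kernelIntegrand_nonneg {t k : ℝ} (ht : 0 < t) (hk : 0 < k) : 0 ≤ kernelIntegrand t k :=
  mul_nonneg (by positivity) (ellipticK_nonneg k)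

lemma measurable_kernelIntegrand (t : ℝ) : Measurable (kernelIntegrand t) := by
  have := measurable_ellipticK
  unfold kernelIntegrand
  fun_prop

lemma integrableOn_kernelIntegrand {t : ℝ} (ht : 0 < t) :
    IntegrableOn (kernelIntegrand t) (Ioo 0 1) := by
  refine ⟨(measurable_kernelIntegrand t).aestronglyMeasurable, ?_⟩
  rw [hasFiniteIntegral_iff_ofReal ((ae_restrict_iff' measurableSet_Ioo).2
    (Eventually.of_forall fun k hk => kernelIntegrand_nonneg ht hk.1)),
    lintegral_kernelIntegrand_eq_agm ht]
  exact ENNReal.ofReal_lt_top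

lemma intervalIntegrable_kernelIntegrand {t : ℝ} (ht : 0 < t) :
    IntervalIntegrable (kernelIntegrand t) volume 0 1 :=
  (intervalIntegrable_iff_integrableOn_Ioo_of_le zero_le_one).2 (integrableOn_kernelIntegrand ht)

lemma kernelIntegral_eq {t : ℝ} (ht : 0 < t) :
    kernelIntegral t = Real.pi / 2 * agmIntegral t := by
  rw [kernelIntegral, intervalIntegral.integral_of_le zero_le_one, integral_Ioc_eq_integral_Ioo,
    integral_eq_lintegral_of_nonneg_ae ((ae_restrict_iff' measurableSet_Ioo).2
      (Eventually.of_forall fun k hk => kernelIntegrand_nonneg ht hk.1))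
      (measurable_kernelIntegrand t).aestronglyMeasurable, lintegral_kernelIntegrand_eq_agm ht,
    ENNReal.toReal_ofReal (mul_nonneg Real.pi_div_two_pos.le (agmIntegral_nonneg t))]

/-! ### Legendre's integrals in terms of Gauss's -/

lemma sqrt_legendre {t : ℝ} (h : t ^ 2 ≤ 1) (φ : ℝ) :
    √(1 - √(1 - t ^ 2) ^ 2 * Real.sin φ ^ 2) = agmDelta t φ := by
  rw [Real.sq_sqrt (by linarith), agmDelta]
  congr 1
  linear_combination -Real.sin_sq_add_cos_sq φ

/-- For `k² = 1 - t⁻²` one has `t² (1 - k² sin² φ) = t² cos² φ + sin² φ`, which is `Δ²` with sine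
and cosine exchanged; hence the reflection of `φ`. -/
lemma sqrt_legendre_inv {t : ℝ} (h : 1 ≤ t) (φ : ℝ) :
    √(1 - √(1 - (t ^ 2)⁻¹) ^ 2 * Real.sin φ ^ 2) = agmDelta t (Real.pi / 2 - φ) / t := by
  have ht : 0 < t := by linarith
  have : (t ^ 2)⁻¹ ≤ 1 := inv_le_one_of_one_le₀ (by nlinarith)
  rw [Real.sq_sqrt (by linarith), agmDelta, eq_div_iff ht.ne', Real.cos_pi_div_two_sub,
    Real.sin_pi_div_two_sub]
  have hmul : ∀ A, √A * t = √(A * t ^ 2) := fun A => by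
    rw [Real.sqrt_mul' _ (sq_nonneg t), Real.sqrt_sq ht.le]
  rw [hmul]
  congr 1
  field_simp
  linear_combination t ^ 2 * -Real.sin_sq_add_cos_sq φ

lemma integral_reflect (f : ℝ → ℝ) :
    ∫ φ in (0 : ℝ)..(Real.pi / 2), f (Real.pi / 2 - φ) = ∫ φ in (0 : ℝ)..(Real.pi / 2), f φ := by
  rw [intervalIntegral.integral_comp_sub_left]; simp

lemma ellipticK_eq {t : ℝ} (h : t ^ 2 ≤ 1) :
    ellipticK √(1 - t ^ 2) = agmIntegral t := by
  simp_rw [ellipticK, agmIntegral, sqrt_legendre h]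

lemma ellipticE_eq {t : ℝ} (h : t ^ 2 ≤ 1) :
    ellipticE √(1 - t ^ 2) = ∫ φ in (0 : ℝ)..(Real.pi / 2), agmDelta t φ := by
  simp_rw [ellipticE, sqrt_legendre h]

lemma ellipticK_inv_eq {t : ℝ} (h : 1 ≤ t) :
    ellipticK √(1 - (t ^ 2)⁻¹) = t * agmIntegral t := by
  simp_rw [ellipticK, sqrt_legendre_inv h]
  rw [integral_reflect (fun φ => 1 / (agmDelta t φ / t)), agmIntegral,
    ← intervalIntegral.integral_const_mul]
  congr with φ
  rw [one_div_div, mul_one_div]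

lemma ellipticE_inv_eq {t : ℝ} (h : 1 ≤ t) :
    ellipticE √(1 - (t ^ 2)⁻¹) = (∫ φ in (0 : ℝ)..(Real.pi / 2), agmDelta t φ) / t := by
  simp_rw [ellipticE, sqrt_legendre_inv h]
  rw [integral_reflect (fun φ => agmDelta t φ / t), intervalIntegral.integral_div]

/-! ### Derivative of Gauss's integral -/

/-- `∫₀^{π/2} sin² φ / √(cos² φ + t² sin² φ) dφ`. -/
noncomputable def agmSinIntegral (t : ℝ) : ℝ :=
  ∫ φ in (0 : ℝ)..(Real.pi / 2), Real.sin φ ^ 2 / agmDelta t φ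

lemma hasDerivAt_inv_agmDelta {t : ℝ} (ht : 0 < t) (φ : ℝ) :
    HasDerivAt (fun s => 1 / agmDelta s φ) (-(t * Real.sin φ ^ 2 / agmDelta t φ ^ 3)) t := by
  have h0 := agmDelta_pos ht φ
  have h1 : HasDerivAt (fun s => agmDelta s φ) _ t :=
    ((((hasDerivAt_id t).pow 2).mul_const (Real.sin φ ^ 2)).const_add (Real.cos φ ^ 2)).sqrt
      (cos_sq_add_sin_sq_pos ht φ).ne'
  simp_rw [one_div]
  refine (h1.inv h0.ne').congr_deriv ?_
  change -(_ / (2 * agmDelta t φ)) / _ = _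
  simp only [id]
  field_simp
  push_cast
  ring

lemma continuous_deriv_agmDelta {t : ℝ} (ht : 0 < t) :
    Continuous fun φ => -(t * Real.sin φ ^ 2 / agmDelta t φ ^ 3) :=
  (Continuous.div (by fun_prop) (by fun_prop)
    fun φ => (pow_pos (agmDelta_pos ht φ) 3).ne').neg

lemma hasDerivAt_agmIntegral {t : ℝ} (ht : 0 < t) :
    HasDerivAt agmIntegral
      (∫ φ in (0 : ℝ)..(Real.pi / 2), -(t * Real.sin φ ^ 2 / agmDelta t φ ^ 3)) t := by
  have ht2 : 0 < t / 2 := by positivity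
  have hball : ∀ s ∈ Metric.ball t (t / 2), t / 2 < s ∧ s < 2 * t := fun s hs => by
    rw [Metric.mem_ball, Real.dist_eq, abs_lt] at hs
    exact ⟨by linarith, by linarith⟩
  refine (intervalIntegral.hasDerivAt_integral_of_dominated_loc_of_deriv_le
    (F := fun s φ => 1 / agmDelta s φ)
    (F' := fun s φ => -(s * Real.sin φ ^ 2 / agmDelta s φ ^ 3))
    -- `Δ` increases with its parameter, so on the ball `t/2 < s < 2t` the denominator is smallest
    -- at `t/2`.
    (bound := fun φ => 2 * t / agmDelta (t / 2) φ ^ 3)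
    (Metric.ball_mem_nhds t ht2) ?_ ((continuous_inv_agmDelta ht).intervalIntegrable _ _)
    (continuous_deriv_agmDelta ht).aestronglyMeasurable ?_
    (Continuous.intervalIntegrable (Continuous.div (by fun_prop) (by fun_prop)
      fun φ => (pow_pos (agmDelta_pos ht2 φ) 3).ne') _ _) ?_).2
  · filter_upwards [Metric.ball_mem_nhds t ht2] with s hs
    exact (continuous_inv_agmDelta (ht2.trans (hball s hs).1)).aestronglyMeasurable
  · refine Eventually.of_forall fun φ _ s hs => ?_
    obtain ⟨h1, h2⟩ := hball s hs
    have hs0 : 0 < s := ht2.trans h1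
    have h3 := agmDelta_pos ht2 φ
    have h4 := agmDelta_pos hs0 φ
    have h5 : agmDelta (t / 2) φ ≤ agmDelta s φ := by
      unfold agmDelta; gcongr
    rw [norm_neg, Real.norm_of_nonneg (by positivity)]
    have h6 : s * Real.sin φ ^ 2 ≤ 2 * t := by nlinarith [Real.sin_sq_le_one φ]
    gcongr
  · exact Eventually.of_forall fun φ _ s hs =>
      hasDerivAt_inv_agmDelta (ht2.trans (hball s hs).1) φ

/-- The difference of the two integrands is the derivative of `sin φ cos φ / Δ`, which vanishes at
`0` and `π/2`. -/
lemma integral_cos_sq_div_agmDelta {t : ℝ} (ht : 0 < t) :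
    ∫ φ in (0 : ℝ)..(Real.pi / 2), Real.cos φ ^ 2 / agmDelta t φ ^ 3 = agmSinIntegral t := by
  have hc1 : Continuous fun φ => Real.cos φ ^ 2 / agmDelta t φ ^ 3 :=
    Continuous.div (by fun_prop) (by fun_prop) fun φ => (pow_pos (agmDelta_pos ht φ) 3).ne'
  have hc2 : Continuous fun φ => Real.sin φ ^ 2 / agmDelta t φ :=
    Continuous.div (by fun_prop) (by fun_prop) fun φ => (agmDelta_pos ht φ).ne'
  have hd : ∀ φ ∈ uIcc 0 (Real.pi / 2), HasDerivAt
      (fun φ => Real.sin φ * Real.cos φ / agmDelta t φ)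
      (Real.cos φ ^ 2 / agmDelta t φ ^ 3 - Real.sin φ ^ 2 / agmDelta t φ) φ := by
    intro φ _
    have h0 := agmDelta_pos ht φ
    have h1 : HasDerivAt (agmDelta t) _ φ :=
      (((Real.hasDerivAt_cos φ).pow 2).add (((Real.hasDerivAt_sin φ).pow 2).const_mul
        (t ^ 2))).sqrt (cos_sq_add_sin_sq_pos ht φ).ne'
    refine (((Real.hasDerivAt_sin φ).mul (Real.hasDerivAt_cos φ)).div h1 h0.ne').congr_deriv ?_
    change (_ * agmDelta t φ - Real.sin φ * Real.cos φ * (_ / (2 * agmDelta t φ))) / _ = _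
    have h2 := agmDelta_sq ht φ
    have hsc := Real.sin_sq_add_cos_sq φ
    field_simp
    push_cast
    rw [h2, ← sub_eq_zero]
    ring_nf
    simp only [Real.sin_sq]
    ring
  have h := intervalIntegral.integral_eq_sub_of_hasDerivAt hd
    ((hc1.sub hc2).intervalIntegrable _ _)
  rw [intervalIntegral.integral_sub (hc1.intervalIntegrable _ _) (hc2.intervalIntegrable _ _)] at h
  simp only [Real.sin_zero, Real.cos_pi_div_two, mul_zero, zero_mul, zero_div, sub_zero] at h
  rw [agmSinIntegral]
  linarith

/-- Pointwise, `1/Δ - t² sin² φ / Δ³ = cos² φ / Δ³`. -/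
lemma agmIntegral_add_mul_deriv {t : ℝ} (ht : 0 < t) :
    agmIntegral t + t * deriv agmIntegral t = agmSinIntegral t := by
  have hc : Continuous fun φ => t * -(t * Real.sin φ ^ 2 / agmDelta t φ ^ 3) :=
    continuous_const.mul (continuous_deriv_agmDelta ht)
  rw [(hasDerivAt_agmIntegral ht).deriv, ← intervalIntegral.integral_const_mul, agmIntegral,
    ← intervalIntegral.integral_add ((continuous_inv_agmDelta ht).intervalIntegrable _ _)
      (hc.intervalIntegrable _ _),
    ← integral_cos_sq_div_agmDelta ht]
  congr with φ
  have h0 := agmDelta_pos ht φ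
  have h2 := agmDelta_sq ht φ
  field_simp
  linarith

lemma integral_agmDelta_sub {t : ℝ} (ht : 0 < t) :
    (∫ φ in (0 : ℝ)..(Real.pi / 2), agmDelta t φ) - agmIntegral t =
      (t ^ 2 - 1) * agmSinIntegral t := by
  rw [agmIntegral, ← intervalIntegral.integral_sub
    ((continuous_agmDelta t).intervalIntegrable _ _)
    ((continuous_inv_agmDelta ht).intervalIntegrable _ _), agmSinIntegral,
    ← intervalIntegral.integral_const_mul]
  congr with φ
  have h0 := agmDelta_pos ht φ
  have h2 := agmDelta_sq ht φ
  field_simp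
  linear_combination h2 + Real.sin_sq_add_cos_sq φ

lemma agmSinIntegral_one : agmSinIntegral 1 = Real.pi / 4 := by
  have : ∀ φ, agmDelta 1 φ = 1 := fun φ => by simp [agmDelta]
  simp_rw [agmSinIntegral, this, div_one, integral_sin_sq]
  simp
  ring

/-! ### Analyticity of `f` -/

lemma integrableOn_ellipticK : IntegrableOn ellipticK (Ioo 0 1) := by
  refine Integrable.mono' (integrableOn_kernelIntegrand one_pos)
    measurable_ellipticK.aestronglyMeasurable ((ae_restrict_iff' measurableSet_Ioo).2
      (Eventually.of_forall fun k hk => ?_))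
  have h := ellipticK_nonneg k
  obtain ⟨h0, h1⟩ := hk
  rw [Real.norm_of_nonneg h, kernelIntegrand]
  -- At `t = 1` the kernel is `2/(1 + k) ≥ 1`, so the convergence of `f(1)` already dominates `K`.
  refine le_mul_of_one_le_left h ?_
  rw [one_mul, add_comm k 1, ← add_div, le_div_iff₀ (by positivity)]
  linarith

/-- The extension of `f` to complex arguments. -/
noncomputable def kernelIntegralComplex (z : ℂ) : ℂ :=
  ∫ k in Ioo (0 : ℝ) 1, (1 / (k + z) + 1 / (1 + z * k)) * (ellipticK k : ℂ)

lemma kernelIntegralComplex_ofReal (t : ℝ) : kernelIntegralComplex t = kernelIntegral t := by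
  rw [kernelIntegral, intervalIntegral.integral_of_le zero_le_one, integral_Ioc_eq_integral_Ioo,
    ← integral_complex_ofReal, kernelIntegralComplex]
  congr with k
  simp [kernelIntegrand]

lemma le_norm_add_of_re {z : ℂ} {k δ : ℝ} (hk : 0 < k) (hz : δ ≤ z.re) :
    δ ≤ ‖(k : ℂ) + z‖ := by
  refine le_trans ?_ (Complex.re_le_norm _)
  simp only [Complex.add_re, Complex.ofReal_re]
  linarith

lemma one_le_norm_one_add_mul {z : ℂ} {k : ℝ} (hk : 0 < k) (hz : 0 < z.re) :
    1 ≤ ‖1 + z * (k : ℂ)‖ := by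
  refine le_trans ?_ (Complex.re_le_norm _)
  have := mul_pos hz hk
  simp
  linarith

lemma norm_kernel_le {z : ℂ} {k δ : ℝ} (hδ : 0 < δ) (hk : 0 < k) (hz : δ ≤ z.re) :
    ‖1 / (k + z) + 1 / (1 + z * k)‖ ≤ 1 / δ + 1 := by
  refine (norm_add_le _ _).trans (add_le_add ?_ ?_)
  · rw [norm_div, norm_one]
    exact one_div_le_one_div_of_le hδ (le_norm_add_of_re hk hz)
  · rw [norm_div, norm_one]
    exact div_le_one_of_le₀ (one_le_norm_one_add_mul hk (hδ.trans_le hz)) (norm_nonneg _)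

lemma norm_kernel_deriv_le {z : ℂ} {k δ : ℝ} (hδ : 0 < δ) (hk : k ∈ Ioo (0 : ℝ) 1)
    (hz : δ ≤ z.re) :
    ‖-1 / (k + z) ^ 2 + -(k : ℂ) / (1 + z * k) ^ 2‖ ≤ 1 / δ ^ 2 + 1 := by
  refine (norm_add_le _ _).trans (add_le_add ?_ ?_)
  · rw [norm_div, norm_neg, norm_one, norm_pow]
    have := le_norm_add_of_re hk.1 hz
    gcongr
  · rw [norm_div, norm_neg, norm_pow, Complex.norm_real, Real.norm_of_nonneg hk.1.le]
    have := one_le_norm_one_add_mul hk.1 (hδ.trans_le hz)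
    refine div_le_one_of_le₀ ?_ (by positivity)
    nlinarith [hk.2]

/-- On a ball of radius `Re z₀ / 2` the real part stays at least `Re z₀ / 2`, so the kernel's
derivative is uniformly bounded there and a multiple of `K` dominates. -/
lemma differentiableAt_kernelIntegralComplex {z₀ : ℂ} (hz₀ : 0 < z₀.re) :
    DifferentiableAt ℂ kernelIntegralComplex z₀ := by
  have hmK := measurable_ellipticK
  have hmeas : ∀ z : ℂ, AEStronglyMeasurable
      (fun k : ℝ => (1 / (k + z) + 1 / (1 + z * k)) * (ellipticK k : ℂ))
      (volume.restrict (Ioo 0 1)) := fun z => by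
    apply Measurable.aestronglyMeasurable; fun_prop
  have hδ : 0 < z₀.re / 2 := by positivity
  have hball : ∀ z ∈ Metric.ball z₀ (z₀.re / 2), z₀.re / 2 ≤ z.re := fun z hz => by
    have h1 := (Complex.abs_re_le_norm (z - z₀)).trans (mem_ball_iff_norm.1 hz).le
    rw [Complex.sub_re] at h1
    linarith [neg_abs_le (z.re - z₀.re)]
  refine (hasDerivAt_integral_of_dominated_loc_of_deriv_le
    (F := fun (z : ℂ) (k : ℝ) => (1 / (k + z) + 1 / (1 + z * k)) * (ellipticK k : ℂ))
    (F' := fun (z : ℂ) (k : ℝ) =>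
      (-1 / (k + z) ^ 2 + -(k : ℂ) / (1 + z * k) ^ 2) * (ellipticK k : ℂ))
    (bound := fun k => (1 / (z₀.re / 2) ^ 2 + 1) * ellipticK k)
    (Metric.ball_mem_nhds z₀ hδ) (Eventually.of_forall hmeas) ?_ ?_ ?_
    (integrableOn_ellipticK.const_mul _) ?_).2.differentiableAt
  · refine Integrable.mono' (integrableOn_ellipticK.const_mul (1 / (z₀.re / 2) + 1)) (hmeas z₀)
      ((ae_restrict_iff' measurableSet_Ioo).2 (Eventually.of_forall fun k hk => ?_))
    rw [norm_mul, Complex.norm_real, Real.norm_of_nonneg (ellipticK_nonneg k)]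
    exact mul_le_mul_of_nonneg_right (norm_kernel_le hδ hk.1 (by linarith)) (ellipticK_nonneg k)
  · apply Measurable.aestronglyMeasurable; fun_prop
  · refine (ae_restrict_iff' measurableSet_Ioo).2 (Eventually.of_forall fun k hk z hz => ?_)
    rw [norm_mul, Complex.norm_real, Real.norm_of_nonneg (ellipticK_nonneg k)]
    exact mul_le_mul_of_nonneg_right (norm_kernel_deriv_le hδ hk (hball z hz)) (ellipticK_nonneg k)
  · refine (ae_restrict_iff' measurableSet_Ioo).2 (Eventually.of_forall fun k hk z hz => ?_)
    have hz' := hball z hz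
    have h1 : (k : ℂ) + z ≠ 0 := norm_pos_iff.1 (hδ.trans_le (le_norm_add_of_re hk.1 hz'))
    have h2 : 1 + z * (k : ℂ) ≠ 0 :=
      norm_pos_iff.1 (one_pos.trans_le (one_le_norm_one_add_mul hk.1 (hδ.trans_le hz')))
    simp_rw [one_div]
    refine HasDerivAt.mul_const (HasDerivAt.add ?_ ?_) _
    · exact ((hasDerivAt_id z).const_add (k : ℂ)).inv h1
    · refine ((((hasDerivAt_id z).mul_const (k : ℂ)).const_add 1).inv h2).congr_deriv ?_
      simp

lemma analyticOnNhd_kernelIntegral : AnalyticOnNhd ℝ kernelIntegral (Ioi 0) := by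
  intro t ht
  have hopen : IsOpen {z : ℂ | 0 < z.re} := isOpen_lt continuous_const Complex.continuous_re
  have hd : DifferentiableOn ℂ kernelIntegralComplex {z : ℂ | 0 < z.re} := fun z hz =>
    (differentiableAt_kernelIntegralComplex hz).differentiableWithinAt
  have h1 : AnalyticAt ℂ kernelIntegralComplex (t : ℂ) :=
    hd.analyticOnNhd hopen t (by simpa using ht)
  have h2 := h1.re_ofReal
  simpa only [kernelIntegralComplex_ofReal, Complex.ofReal_re] using h2

/-! ### Integration over the cylinder -/

lemma measurePreserving_strip : MeasurePreserving Complex.measurableEquivRealProd.symm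
    ((volume : Measure ℝ).prod (volume.restrict (Ioc (-Real.pi) Real.pi)))
    (volume.restrict cylinderStrip) := by
  have h := Complex.volume_preserving_equiv_real_prod.symm.restrict_preimage_emb
    Complex.measurableEquivRealProd.symm.measurableEmbedding cylinderStrip
  have hs : Complex.measurableEquivRealProd.symm ⁻¹' cylinderStrip =
      univ ×ˢ Ioc (-Real.pi) Real.pi := by
    ext p
    simp [cylinderStrip]
  rwa [hs, Measure.volume_eq_prod, ← Measure.prod_restrict, Measure.restrict_univ] at h

lemma norm_cosh_sq (x y : ℝ) :
    ‖Complex.cosh (x + y * Complex.I)‖ ^ 2 = (Real.cosh (2 * x) + Real.cos (2 * y)) / 2 := by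
  have h : Complex.cosh (x + y * Complex.I) =
      ((Real.cosh x * Real.cos y : ℝ) : ℂ) + ((Real.sinh x * Real.sin y : ℝ) : ℂ) * Complex.I := by
    rw [Complex.cosh_add, Complex.cosh_mul_I, Complex.sinh_mul_I]
    push_cast
    ring
  rw [h, ← Complex.normSq_eq_norm_sq, Complex.normSq_add_mul_I, Real.cosh_two_mul,
    Real.cos_two_mul]
  have h1 := Real.cosh_sq x
  have h2 := Real.sin_sq y
  rw [mul_pow, mul_pow, h2]
  have h3 : Real.sinh x ^ 2 = Real.cosh x ^ 2 - 1 := by linarith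
  rw [h3]
  ring

lemma lintegral_inv_norm_cosh_sq_add_im {b : ℝ} (hb : 0 < b) (x : ℝ) :
    ∫⁻ y in Ioc (-Real.pi) Real.pi,
        ENNReal.ofReal (1 / (‖Complex.cosh (x + y * Complex.I)‖ ^ 2 + b)) =
      ENNReal.ofReal (4 * Real.pi / √((Real.cosh (2 * x) + 2 * b) ^ 2 - 1)) := by
  have hx := Real.one_le_cosh (2 * x)
  set m := Real.cosh (2 * x) + 2 * b with hm
  have hpos : ∀ y, 0 < m + Real.cos y := fun y => by linarith [Real.neg_one_le_cos y]
  have e : ∀ y : ℝ, 1 / (‖Complex.cosh (x + y * Complex.I)‖ ^ 2 + b) =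
      2 * (1 / (m + Real.cos (2 * y))) := fun y => by
    have h1 := hpos (2 * y)
    have h2 : (Real.cosh (2 * x) + Real.cos (2 * y)) / 2 + b = (m + Real.cos (2 * y)) / 2 := by
      rw [hm]; ring
    rw [norm_cosh_sq, h2]
    field_simp
  have hc : Continuous fun y => 2 * (1 / (m + Real.cos (2 * y))) :=
    continuous_const.mul (continuous_const.div (by fun_prop) fun y => (hpos (2 * y)).ne')
  have hpi : -Real.pi ≤ Real.pi := by linarith [Real.pi_pos]
  simp_rw [e]
  rw [← setLIntegral_congr Ioo_ae_eq_Ioc, lintegral_Ioo_ofReal hpi hc.continuousOn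
    (fun y => by have := hpos (2 * y); positivity), intervalIntegral.integral_const_mul,
    intervalIntegral.integral_comp_mul_left (fun u => 1 / (m + Real.cos u)) two_ne_zero,
    integral_inv_add_cos (by linarith) _ _ (by simp [Real.sin_two_mul])
      (by simp [Real.sin_two_mul]), smul_eq_mul]
  congr 1
  ring

/-- This is where the metric meets `f`: `c = cosh 2x` on the half-line `x > 0` produces exactly the
integral over `c` that evaluates `f(b)`. -/
lemma lintegral_cosh_two_mul {b : ℝ} (hb : 0 < b) :
    ∫⁻ x, ENNReal.ofReal (4 * Real.pi / √((Real.cosh (2 * x) + 2 * b) ^ 2 - 1)) =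
      4 * ENNReal.ofReal (kernelIntegral b) := by
  have hf : kernelIntegral b = Real.pi / 2 * agmIntegral b := kernelIntegral_eq hb
  have hbij : BijOn (fun x => Real.cosh (2 * x)) (Ioi 0) (Ioi 1) := by
    refine ⟨fun x hx => Real.one_lt_cosh.2 (mul_pos two_pos hx).ne', fun x hx y hy h => ?_,
      fun c hc => ⟨Real.arcosh c / 2, half_pos (Real.arcosh_pos hc), ?_⟩⟩
    · have := Real.cosh_injOn (mem_Ici.2 (mul_pos two_pos hx).le)
        (mem_Ici.2 (mul_pos two_pos hy).le) h
      linarith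
    · simp only
      rw [mul_div_cancel₀ _ two_ne_zero, Real.cosh_arcosh (le_of_lt hc)]
  have hsub := lintegral_ofReal_subst
    (g := fun c => Real.pi / √((c ^ 2 - 1) * ((c + 2 * b) ^ 2 - 1)))
    (h := fun x => 2 * Real.pi / √((Real.cosh (2 * x) + 2 * b) ^ 2 - 1)) measurableSet_Ioi
    (fun x _ => ((hasDerivAt_id x).const_mul 2).cosh) hbij (fun x hx => by
      have hs : 0 < Real.sinh (2 * x) := Real.sinh_pos_iff.2 (mul_pos two_pos hx)
      have h1 : Real.cosh (2 * x) ^ 2 - 1 = Real.sinh (2 * x) ^ 2 := by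
        rw [Real.cosh_sq]; ring
      have h2 : 0 < √((Real.cosh (2 * x) + 2 * b) ^ 2 - 1) := by
        have := Real.one_le_cosh (2 * x)
        exact Real.sqrt_pos.2 (by nlinarith)
      simp only [id]
      rw [h1, Real.sqrt_mul (sq_nonneg _), Real.sqrt_sq hs.le, abs_of_pos (by positivity)]
      field_simp)
  rw [← lintegral_kernelIntegrand_eq_quartic hb, lintegral_kernelIntegrand_eq_agm hb, ← hf] at hsub
  have h4 : ∀ x, ENNReal.ofReal (4 * Real.pi / √((Real.cosh (2 * x) + 2 * b) ^ 2 - 1)) =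
      2 * ENNReal.ofReal (2 * Real.pi / √((Real.cosh (2 * x) + 2 * b) ^ 2 - 1)) := fun x => by
    rw [← ENNReal.ofReal_ofNat 2, ← ENNReal.ofReal_mul (by positivity)]
    congr 1
    ring
  simp_rw [h4]
  rw [lintegral_const_mul _ (by fun_prop), lintegral_even (fun x => by simp), ← hsub, ← mul_assoc]
  norm_num

lemma lintegral_strip_inv_norm_cosh_sq_add {b : ℝ} (hb : 0 < b) :
    ∫⁻ z in cylinderStrip, ENNReal.ofReal (1 / (‖Complex.cosh z‖ ^ 2 + b)) =
      4 * ENNReal.ofReal (kernelIntegral b) := by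
  rw [← measurePreserving_strip.lintegral_comp_emb
    Complex.measurableEquivRealProd.symm.measurableEmbedding,
    lintegral_prod _ (by fun_prop), ← lintegral_cosh_two_mul hb]
  refine lintegral_congr fun x => ?_
  rw [← lintegral_inv_norm_cosh_sq_add_im hb x]
  simp [Complex.mk_eq_add_mul_I]

lemma integrableOn_inv_norm_cosh_sq_add {b : ℝ} (hb : 0 < b) :
    IntegrableOn (fun z => 1 / (‖Complex.cosh z‖ ^ 2 + b)) cylinderStrip := by
  refine ⟨Measurable.aestronglyMeasurable (by fun_prop), ?_⟩
  rw [hasFiniteIntegral_iff_ofReal (Eventually.of_forall fun z => by positivity),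
    lintegral_strip_inv_norm_cosh_sq_add hb]
  exact ENNReal.mul_lt_top (by simp) ENNReal.ofReal_lt_top

lemma kernelIntegral_nonneg {t : ℝ} (ht : 0 < t) : 0 ≤ kernelIntegral t := by
  rw [kernelIntegral_eq ht]
  exact mul_nonneg Real.pi_div_two_pos.le (agmIntegral_nonneg t)

lemma integral_inv_norm_cosh_sq_add {b : ℝ} (hb : 0 < b) :
    ∫ z in cylinderStrip, 1 / (‖Complex.cosh z‖ ^ 2 + b) = 4 * kernelIntegral b := by
  rw [integral_eq_lintegral_of_nonneg_ae (Eventually.of_forall fun z => by positivity)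
    (integrableOn_inv_norm_cosh_sq_add hb).aestronglyMeasurable,
    lintegral_strip_inv_norm_cosh_sq_add hb]
  simp [kernelIntegral_nonneg hb]

lemma hasDerivAt_integral_inv_norm_cosh_sq_add {b : ℝ} (hb : 0 < b) :
    IntegrableOn (fun z => -1 / (‖Complex.cosh z‖ ^ 2 + b) ^ 2) cylinderStrip ∧
    HasDerivAt (fun s => ∫ z in cylinderStrip, 1 / (‖Complex.cosh z‖ ^ 2 + s))
      (∫ z in cylinderStrip, -1 / (‖Complex.cosh z‖ ^ 2 + b) ^ 2) b := by
  have hb2 : 0 < b / 2 := by positivity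
  have hball : ∀ s ∈ Metric.ball b (b / 2), b / 2 < s := fun s hs => by
    rw [Metric.mem_ball, Real.dist_eq, abs_lt] at hs
    linarith
  refine hasDerivAt_integral_of_dominated_loc_of_deriv_le
    (F := fun s z => 1 / (‖Complex.cosh z‖ ^ 2 + s))
    (F' := fun s z => -1 / (‖Complex.cosh z‖ ^ 2 + s) ^ 2)
    -- For `s > b/2` one factor of `(C + s)²` is at least `b/2` and the other at least `C + b/2`;
    -- the bound is integrable by the preceding evaluation at `b/2`.
    (bound := fun z => 2 / b * (1 / (‖Complex.cosh z‖ ^ 2 + b / 2)))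
    (Metric.ball_mem_nhds b hb2)
    (Eventually.of_forall fun s => Measurable.aestronglyMeasurable (by fun_prop))
    (integrableOn_inv_norm_cosh_sq_add hb) (Measurable.aestronglyMeasurable (by fun_prop)) ?_
    ((integrableOn_inv_norm_cosh_sq_add hb2).const_mul _) ?_
  · refine Eventually.of_forall fun z s hs => ?_
    have h1 := hball s hs
    have hs0 : 0 < s := hb2.trans h1
    set C := ‖Complex.cosh z‖ ^ 2
    have hC : 0 ≤ C := sq_nonneg _
    rw [neg_div, norm_neg, Real.norm_of_nonneg (by positivity),
      show 2 / b * (1 / (C + b / 2)) = 1 / (b / 2 * (C + b / 2)) by field_simp]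
    refine one_div_le_one_div_of_le (by positivity) ?_
    nlinarith
  · refine Eventually.of_forall fun z s hs => ?_
    have hs0 : 0 < s := hb2.trans (hball s hs)
    have : ‖Complex.cosh z‖ ^ 2 + s ≠ 0 := by positivity
    simp_rw [one_div]
    exact ((hasDerivAt_id s).const_add _).inv this

/-! ### The conformal factor -/

/-- The density `|sech z|² / (1 + a² |sech z|²)²`. -/
noncomputable def sechDensity (a : ℝ) (z : ℂ) : ℝ :=
  ‖(Complex.cosh z)⁻¹‖ ^ 2 / (1 + a ^ 2 * ‖(Complex.cosh z)⁻¹‖ ^ 2) ^ 2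

lemma sechDensity_eq {a : ℝ} (ha : 0 < a) (z : ℂ) :
    sechDensity a z = 1 / (‖Complex.cosh z‖ ^ 2 + a ^ 2) +
      a ^ 2 * (-1 / (‖Complex.cosh z‖ ^ 2 + a ^ 2) ^ 2) := by
  rw [sechDensity, norm_inv]
  -- At a pole of `sech z` the inverse is read as `0`, so the density is `0`; the right side agrees,
  -- being `1/a² - a²/a⁴`.
  rcases eq_or_ne ‖Complex.cosh z‖ 0 with h | h
  · rw [h]
    field_simp
    simp
  · have : 0 < ‖Complex.cosh z‖ := lt_of_le_of_ne (norm_nonneg _) h.symm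
    have h1 : 1 + a ^ 2 * ‖Complex.cosh z‖⁻¹ ^ 2 =
        (‖Complex.cosh z‖ ^ 2 + a ^ 2) / ‖Complex.cosh z‖ ^ 2 := by field_simp
    rw [h1]
    field_simp
    ring

lemma integrableOn_sechDensity {a : ℝ} (ha : 0 < a) :
    IntegrableOn (sechDensity a) cylinderStrip := by
  have hb : 0 < a ^ 2 := by positivity
  rw [funext (sechDensity_eq ha)]
  exact (integrableOn_inv_norm_cosh_sq_add hb).add
    ((hasDerivAt_integral_inv_norm_cosh_sq_add hb).1.const_mul _)

lemma conformalFactor_eq_integral {a : ℝ} (ha : 0 < a) :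
    conformalFactor a = 4 * ∫ z in cylinderStrip, sechDensity a z := by
  have hemb := Complex.measurableEquivRealProd.symm.measurableEmbedding
  have hint := (measurePreserving_strip.integrable_comp_emb hemb).2 (integrableOn_sechDensity ha)
  rw [← measurePreserving_strip.integral_comp hemb, conformalFactor,
    intervalIntegral.integral_of_le (by linarith [Real.pi_pos])]
  refine congrArg (4 * ·) (Eq.trans ?_ (integral_prod_symm _ hint).symm)
  simp [sechDensity, Complex.mk_eq_add_mul_I]

lemma conformalFactor_eq_kernelIntegral {a : ℝ} (ha : 0 < a) :
    conformalFactor a =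
      16 * kernelIntegral (a ^ 2) + 16 * a ^ 2 * deriv kernelIntegral (a ^ 2) := by
  have hb : 0 < a ^ 2 := by positivity
  obtain ⟨h1, h2⟩ := hasDerivAt_integral_inv_norm_cosh_sq_add hb
  have h3 : (fun s => ∫ z in cylinderStrip, 1 / (‖Complex.cosh z‖ ^ 2 + s)) =ᶠ[𝓝 (a ^ 2)]
      fun s => 4 * kernelIntegral s := by
    filter_upwards [Ioi_mem_nhds hb] with s hs
    exact integral_inv_norm_cosh_sq_add hs
  have h4 := h2.deriv
  rw [h3.deriv_eq, deriv_const_mul_field] at h4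
  rw [conformalFactor_eq_integral ha, funext (sechDensity_eq ha),
    integral_add (integrableOn_inv_norm_cosh_sq_add hb) (h1.const_mul _), integral_const_mul,
    integral_inv_norm_cosh_sq_add hb, ← h4]
  ring

lemma conformalFactor_eq_agmSinIntegral {a : ℝ} (ha : 0 < a) :
    conformalFactor a = 8 * Real.pi * agmSinIntegral (a ^ 2) := by
  have hb : 0 < a ^ 2 := by positivity
  have h3 : kernelIntegral =ᶠ[𝓝 (a ^ 2)] fun s => Real.pi / 2 * agmIntegral s := by
    filter_upwards [Ioi_mem_nhds hb] with s hs
    exact kernelIntegral_eq hs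
  rw [conformalFactor_eq_kernelIntegral ha, h3.deriv_eq, deriv_const_mul_field,
    kernelIntegral_eq hb, ← agmIntegral_add_mul_deriv hb]
  ring

lemma continuousAt_conformalFactor {a : ℝ} (ha : 0 < a) : ContinuousAt conformalFactor a := by
  have h : conformalFactor =ᶠ[𝓝 a] fun a =>
      16 * kernelIntegral (a ^ 2) + 16 * a ^ 2 * deriv kernelIntegral (a ^ 2) := by
    filter_upwards [Ioi_mem_nhds ha] with s hs
    exact conformalFactor_eq_kernelIntegral hs
  rw [continuousAt_congr h]
  have hb : a ^ 2 ∈ Ioi (0 : ℝ) := by rw [mem_Ioi]; positivity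
  have h1 := (analyticOnNhd_kernelIntegral _ hb).continuousAt
  have h2 := (analyticOnNhd_kernelIntegral _ hb).deriv.continuousAt
  have h3 : ContinuousAt (fun a : ℝ => a ^ 2) a := by fun_prop
  exact (continuousAt_const.mul (h1.comp (f := fun a => a ^ 2) h3)).add
    ((continuousAt_const.mul h3).mul (h2.comp (f := fun a => a ^ 2) h3))

/-! ### The metric in polar coordinates -/

/-- This is `dα = (da + i a dϑ) e^{iϑ}`; the common phase drops out of the inner product, leaving
`da² + a² dϑ²`. -/
lemma polarTangent_eq (q v : ℝ × ℝ) (z : ℂ) :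
    polarTangent q v z =
      (v.1 + q.1 * v.2 * Complex.I) * Complex.exp (q.2 * Complex.I) * (Complex.cosh z)⁻¹ := by
  have h1 : HasFDerivAt (fun q : ℝ × ℝ => (q.1 : ℂ))
      (Complex.ofRealCLM.comp (ContinuousLinearMap.fst ℝ ℝ ℝ)) q :=
    (Complex.ofRealCLM.comp (ContinuousLinearMap.fst ℝ ℝ ℝ)).hasFDerivAt
  have h2 : HasFDerivAt (fun q : ℝ × ℝ => (q.2 : ℂ))
      (Complex.ofRealCLM.comp (ContinuousLinearMap.snd ℝ ℝ ℝ)) q :=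
    (Complex.ofRealCLM.comp (ContinuousLinearMap.snd ℝ ℝ ℝ)).hasFDerivAt
  have h3 : HasFDerivAt (fun q : ℝ × ℝ => polarLump q z) _ q :=
    (h1.mul (h2.mul_const Complex.I).cexp).mul_const (Complex.cosh z)⁻¹
  rw [polarTangent, h3.fderiv]
  simp
  ring

lemma sphereInner_polar {a : ℝ} (ha : 0 < a) (ϑ : ℝ) (v w : ℝ × ℝ) :
    sphereInner (polarLump (a, ϑ)) (polarTangent (a, ϑ) v) (polarTangent (a, ϑ) w) =
      fun z => 4 * (v.1 * w.1 + a ^ 2 * (v.2 * w.2)) * sechDensity a z := by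
  ext z
  have hexp : ‖Complex.exp (ϑ * Complex.I)‖ = 1 := Complex.norm_exp_ofReal_mul_I ϑ
  have hW : ‖polarLump (a, ϑ) z‖ ^ 2 = a ^ 2 * ‖(Complex.cosh z)⁻¹‖ ^ 2 := by
    simp only [polarLump, sechLump, norm_mul, hexp, Complex.norm_real, Real.norm_of_nonneg ha.le]
    ring
  have hXY : (polarTangent (a, ϑ) v z * (starRingEnd ℂ) (polarTangent (a, ϑ) w z)).re =
      (v.1 * w.1 + a ^ 2 * (v.2 * w.2)) * ‖(Complex.cosh z)⁻¹‖ ^ 2 := by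
    simp only [polarTangent_eq, map_mul]
    set e := Complex.exp (ϑ * Complex.I)
    set s := (Complex.cosh z)⁻¹
    have he : e * (starRingEnd ℂ) e = 1 := by
      rw [Complex.mul_conj, Complex.normSq_eq_norm_sq, hexp]; simp
    have hs : s * (starRingEnd ℂ) s = ((‖s‖ ^ 2 : ℝ) : ℂ) := by
      rw [Complex.mul_conj, Complex.normSq_eq_norm_sq]
    have : (↑v.1 + ↑a * ↑v.2 * Complex.I) * e * s *
        ((starRingEnd ℂ) (↑w.1 + ↑a * ↑w.2 * Complex.I) * (starRingEnd ℂ) e *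
          (starRingEnd ℂ) s) =
        (↑v.1 + ↑a * ↑v.2 * Complex.I) * (starRingEnd ℂ) (↑w.1 + ↑a * ↑w.2 * Complex.I) *
          ((‖s‖ ^ 2 : ℝ) : ℂ) := by
      rw [← hs]
      linear_combination (↑v.1 + ↑a * ↑v.2 * Complex.I) *
        (starRingEnd ℂ) (↑w.1 + ↑a * ↑w.2 * Complex.I) * (s * (starRingEnd ℂ) s) * he
    rw [this, Complex.re_mul_ofReal]
    congr 1
    simp
    ring
  rw [sphereInner, hW, hXY, sechDensity]
  ring

end CylinderLump

theorem mainTheorem3 :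
    -- the integral defining `f` converges for `t > 0`, and `f` is analytic on `(0, ∞)`
    (∀ t : ℝ, 0 < t → IntervalIntegrable (kernelIntegrand t) volume 0 1) ∧
    AnalyticOnNhd ℝ kernelIntegral (Ioi 0) ∧
    -- closed form of `f`
    (∀ t : ℝ, 0 < t → t ≤ 1 →
      kernelIntegral t = Real.pi / 2 * ellipticK (Real.sqrt (1 - t ^ 2))) ∧
    (∀ t : ℝ, 1 < t →
      kernelIntegral t = Real.pi / (2 * t) * ellipticK (Real.sqrt (1 - (t ^ 2)⁻¹))) ∧
    -- the metric on `Ξ₀` is `I(a) (da² + a² dϑ²)`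
    (∀ a ϑ : ℝ, 0 < a → ∀ v w : ℝ × ℝ,
      IntegrableOn
        (sphereInner (polarLump (a, ϑ)) (polarTangent (a, ϑ) v) (polarTangent (a, ϑ) w))
        cylinderStrip ∧
      l2Metric (polarLump (a, ϑ)) (polarTangent (a, ϑ) v) (polarTangent (a, ϑ) w) =
        conformalFactor a * (v.1 * w.1 + a ^ 2 * (v.2 * w.2))) ∧
    -- the conformal factor in terms of `f` and its derivative
    (∀ a : ℝ, 0 < a →
      conformalFactor a =
        16 * kernelIntegral (a ^ 2) + 16 * a ^ 2 * deriv kernelIntegral (a ^ 2)) ∧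
    -- closed form of the conformal factor; at `a = 1` it is the limit of both expressions
    (∀ a : ℝ, 0 < a → a < 1 →
      conformalFactor a = 8 * Real.pi / (a ^ 4 - 1) *
        (ellipticE (Real.sqrt (1 - a ^ 4)) - ellipticK (Real.sqrt (1 - a ^ 4)))) ∧
    (∀ a : ℝ, 1 < a →
      conformalFactor a = 8 * Real.pi / (a ^ 4 - 1) *
        (a ^ 2 * ellipticE (Real.sqrt (1 - (a ^ 4)⁻¹)) -
          (a ^ 2)⁻¹ * ellipticK (Real.sqrt (1 - (a ^ 4)⁻¹)))) ∧
    conformalFactor 1 = 2 * Real.pi ^ 2 ∧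
    ContinuousAt conformalFactor 1 := by
  refine ⟨fun t ht => intervalIntegrable_kernelIntegrand ht, analyticOnNhd_kernelIntegral,
    fun t ht h1 => ?_, fun t h1 => ?_, fun a ϑ ha v w => ⟨?_, ?_⟩,
    fun a ha => conformalFactor_eq_kernelIntegral ha, fun a ha h1 => ?_, fun a h1 => ?_, ?_,
    continuousAt_conformalFactor one_pos⟩
  · rw [kernelIntegral_eq ht, ellipticK_eq (by nlinarith)]
  · have ht : 0 < t := one_pos.trans h1
    rw [kernelIntegral_eq ht, ellipticK_inv_eq h1.le]
    field_simp
  · rw [sphereInner_polar ha]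
    exact (integrableOn_sechDensity ha).const_mul _
  · rw [l2Metric, sphereInner_polar ha, integral_const_mul, conformalFactor_eq_integral ha]
    ring
  · have h2 : a ^ 2 < 1 := by nlinarith
    have h4 : a ^ 4 = (a ^ 2) ^ 2 := by ring
    have h5 : (a ^ 2) ^ 2 < 1 := by nlinarith [sq_nonneg a]
    have h6 : (a ^ 2) ^ 2 - 1 ≠ 0 := by linarith
    rw [h4, ellipticE_eq h5.le, ellipticK_eq h5.le, integral_agmDelta_sub (by positivity),
      conformalFactor_eq_agmSinIntegral ha, ← mul_assoc, div_mul_cancel₀ _ h6]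
  · have ha : 0 < a := one_pos.trans h1
    have h2 : 1 < a ^ 2 := by nlinarith
    have h4 : a ^ 4 = (a ^ 2) ^ 2 := by ring
    have h6 : (a ^ 2) ^ 2 - 1 ≠ 0 := by nlinarith
    -- With `t = a²`, the weights `a²` and `a⁻²` cancel the factors `1/t` and `t` relating `E` and
    -- `K` at the inverted modulus to `∫ Δ` and `G`, so this case ends as for `a < 1`.
    rw [h4, ellipticE_inv_eq h2.le, ellipticK_inv_eq h2.le,
      mul_div_cancel₀ _ (by positivity : a ^ 2 ≠ 0),
      inv_mul_cancel_left₀ (by positivity : a ^ 2 ≠ 0), integral_agmDelta_sub (by positivity),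
      conformalFactor_eq_agmSinIntegral ha, ← mul_assoc, div_mul_cancel₀ _ h6]
  · rw [conformalFactor_eq_agmSinIntegral one_pos, one_pow, agmSinIntegral_one]
    ring
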